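/- An \emph{ai-semiring} is an algebra $(S,+,\cdot)$ with two binary operations such that $(S,+)$ is a commutative idempotent semigroup, $(S,\cdot)$ is a semigroup, and both distributive laws hold. Let $S_{(4,123)}$ be the algebra with carrier $\{\infty,a,1,b\}$ and the following operations (rows and columns in the order $\infty,a,1,b$): \[ \begin{array}{c|cccc} +&\infty&a&1&b\\ \hline \infty&\infty&\infty&\infty&\infty\\ a&\infty&a&\infty&\infty\\ 1&\infty&\infty&1&b\\ b&\infty&\infty&b&b \end{array} \qquad \begin{array}{c|cccc} \cdot&\infty&a&1&b\\ \hline \infty&\infty&\infty&\infty&\infty\\ a&\infty&\infty&a&\infty\\ 1&\infty&a&1&b\\ b&\infty&\infty&b&\infty \end{array} \] Then: (i) $S_{(4,123)}$ is an ai-semiring. (ii) Let $\mathbb H=\langle V,E\rangle$ be a finite $3$-uniform hypergraph (that is, $V$ is finite and $E$ is a set of $3$-element subsets of $V$) in which every vertex lies in a hyperedge and which is not $2$-colourable (that is, there is no map $V\to\{0,1\}$ that takes both values on every hyperedge), with $E\neq\varnothing$. Let $\mathbf t_{\mathbb H}$ be the sum of all words $x_{v_1}x_{v_2}x_{v_3}$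 with $\{v_1,v_2,v_3\}\in E$, where every hyperedge contributes all six orderings of its vertices. Then $S_{(4,123)}$ satisfies the identity $\mathbf t_{\mathbb H}\approx\mathbf t_{\mathbb H}+x_v$ for every vertex $v\in V$. (iii) $S_{(4,123)}$ is nonfinitely based: the variety that it generates (the smallest class of algebras with two binary operations that contains it and is closed under subalgebras, homomorphic images and arbitrary direct products) is not the class of all models of any finite set of identities. -/

import Mathlib

namespace FiniteBasis

universe u v

/-- `(S, +, ·)` is an additively idempotent semiring: `(S, +)` is a commutative idempotent
semigroup, `(S, ·)` is a semigroup, and both distributive laws hold. -/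
structure IsAISemiring (S : Type u) [Add S] [Mul S] : Prop where
  add_assoc : ∀ x y z : S, (x + y) + z = x + (y + z)
  add_comm : ∀ x y : S, x + y = y + x
  add_idem : ∀ x : S, x + x = x
  mul_assoc : ∀ x y z : S, (x * y) * z = x * (y * z)
  add_mul : ∀ x y z : S, (x + y) * z = x * z + y * z
  mul_add : ∀ x y z : S, x * (y + z) = x * y + x * z

/-- Terms over the variable set `X` in the signature of two binary operations. -/
inductive BTerm (X : Type u) : Type u
  | var : X → BTerm X
  | add : BTerm X → BTerm X → BTerm X
  | mul : BTerm X → BTerm X → BTerm X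

namespace BTerm

/-- The value of a term under an assignment of the variables. -/
def eval {X : Type u} {S : Type v} [Add S] [Mul S] (φ : X → S) : BTerm X → S
  | var x => φ x
  | add s t => eval φ s + eval φ t
  | mul s t => eval φ s * eval φ t

/-- The formal sum of a nonempty list of terms. -/
def sum {X : Type u} : (l : List (BTerm X)) → l ≠ [] → BTerm X
  | [], h => absurd rfl h
  | [t], _ => t
  | t :: s :: l, _ => add t (sum (s :: l) (List.cons_ne_nil s l))

end BTerm

/-- The algebra `S` satisfies the identity `s ≈ t`. -/
def Satisfies (S : Type v) [Add S] [Mul S] {X : Type u} (s t : BTerm X) : Prop :=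
  ∀ φ : X → S, s.eval φ = t.eval φ

/-- A (nonempty) algebra with two binary operations, bundled. -/
structure BAlg : Type 1 where
  carrier : Type
  [nonempty : Nonempty carrier]
  [add : Add carrier]
  [mul : Mul carrier]

instance : CoeSort BAlg Type := ⟨BAlg.carrier⟩

attribute [instance] BAlg.nonempty BAlg.add BAlg.mul

/-- Homomorphisms of algebras with two binary operations. -/
def IsHom {S T : Type} [Add S] [Mul S] [Add T] [Mul T] (f : S → T) : Prop :=
  (∀ x y, f (x + y) = f x + f y) ∧ ∀ x y, f (x * y) = f x * f y

/-- The direct product of a family of algebras. -/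
def BAlg.pi {I : Type} (B : I → BAlg) : BAlg where
  carrier := ∀ i, B i

/-- A variety: a class of algebras closed under subalgebras (up to isomorphism),
homomorphic images and arbitrary direct products. -/
structure IsVariety (K : Set BAlg) : Prop where
  sub : ∀ B ∈ K, ∀ (C : BAlg) (f : C → B), IsHom f → Function.Injective f → C ∈ K
  image : ∀ B ∈ K, ∀ (C : BAlg) (f : B → C), IsHom f → Function.Surjective f → C ∈ K
  prod : ∀ (I : Type) (B : I → BAlg), (∀ i, B i ∈ K) → BAlg.pi B ∈ K

/-- The variety generated by an algebra: the smallest variety that contains it. -/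
def generatedVariety (A : BAlg) : Set BAlg :=
  {B | ∀ K : Set BAlg, IsVariety K → A ∈ K → B ∈ K}

/-- The class of all algebras that satisfy every identity in `E`; the variables are taken from
the countably infinite set `ℕ`. -/
def models (E : Set (BTerm ℕ × BTerm ℕ)) : Set BAlg :=
  {B | ∀ e ∈ E, Satisfies B e.1 e.2}

/-- A class of algebras is finitely based if it is defined by finitely many identities. -/
def FinitelyBasedClass (K : Set BAlg) : Prop :=
  ∃ E : Set (BTerm ℕ × BTerm ℕ), E.Finite ∧ K = models E

/-- An algebra is nonfinitely based if the variety that it generates is not finitely based. -/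
def NonfinitelyBased (S : Type) [Nonempty S] [Add S] [Mul S] : Prop :=
  ¬ FinitelyBasedClass (generatedVariety ⟨S⟩)

/-- A `3`-uniform hypergraph on a vertex set `V`. -/
structure Hypergraph3 (V : Type u) where
  edges : Set (Finset V)
  card_edge : ∀ e ∈ edges, e.card = 3

namespace Hypergraph3

variable {V : Type u}

/-- There is a colouring of the vertices by two colours that takes both values on each
hyperedge. -/
def TwoColourable (H : Hypergraph3 V) : Prop :=
  ∃ φ : V → Bool, ∀ e ∈ H.edges, (e.image φ).card = 2

/-- Every vertex lies in a hyperedge. -/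
def NoIsolatedVertices (H : Hypergraph3 V) : Prop :=
  ∀ v : V, ∃ e ∈ H.edges, v ∈ e

open Classical in
/-- The ordered triples `(v₁, v₂, v₃)` such that `{v₁, v₂, v₃}` is a hyperedge. -/
noncomputable def triples [Fintype V] (H : Hypergraph3 V) : Finset (V × V × V) :=
  Finset.univ.filter fun p => ({p.1, p.2.1, p.2.2} : Finset V) ∈ H.edges

open Classical in
theorem triples_nonempty [Fintype V] (H : Hypergraph3 V) (h : H.edges.Nonempty) :
    H.triples.Nonempty := by
  obtain ⟨e, he⟩ := h
  obtain ⟨x, y, z, -, -, -, rfl⟩ := Finset.card_eq_three.1 (H.card_edge e he)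
  exact ⟨(x, y, z), by simpa [triples] using he⟩

/-- The word `x_{v₁} x_{v₂} x_{v₃}`. -/
def word (p : V × V × V) : BTerm V :=
  .mul (.mul (.var p.1) (.var p.2.1)) (.var p.2.2)

/-- The term `t_H`: the sum (in some fixed order) of all words `x_{v₁} x_{v₂} x_{v₃}` with
`{v₁, v₂, v₃}` a hyperedge of `H`, every hyperedge contributing all six orderings. -/
noncomputable def term [Fintype V] (H : Hypergraph3 V) (h : H.edges.Nonempty) : BTerm V :=
  BTerm.sum (H.triples.toList.map word)
    (by simpa using (H.triples_nonempty h).ne_empty)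

end Hypergraph3

/-- The carrier `{∞, a, 1, b}` of the algebra `S_(4,123)`. -/
inductive S4123 : Type
  | inf | a | one | b

namespace S4123

instance : Nonempty S4123 := ⟨inf⟩

/-- Addition: the join for the order in which `∞` is the top element, `1 < b < ∞` and
`a < ∞`. -/
instance : Add S4123 where
  add
    | a, a => a
    | one, one => one
    | one, b => b
    | b, one => b
    | b, b => b
    | _, _ => inf

/-- Multiplication: `1` is the identity element, all other products are `∞`. -/
instance : Mul S4123 where
  mul
    | one, one => one
    | one, a => a
    | a, one => a
    | one, b => b
    | b, one => b
    | _, _ => inf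

end S4123

end FiniteBasis

namespace FiniteBasis

/-! In `S4123` each of the sets {1}, {a} and {1, b} contains a sum exactly when it contains every
summand. A sum of three-letter words therefore absorbs each first letter unless every word has value
`a`. In that case each word has exactly one letter `a` and two letters `1`, and the positions of `a`
give a 2-colouring. On the cycle of length n, the same situation would give a set of vertices
meeting every three consecutive vertices exactly once, which forces 3 ∣ n by double counting.

For the nonfinite basis, take n ≡ 1 mod 3 large and let L be the language of cyclic triples. Its
syntactic algebra violates the cycle identity, but satisfies every identity of `S4123` that is short
compared with n. Indeed, if u(σ) ⊆ L with u short, then, apart from full triples occurring as values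
of variables, only boundedly many vertices occur. Moving those triples to one fixed place leaves a
vertex c unused. Cutting the cycle at c gives three mod-3 classes, each meeting every word of u(σ)
once. Substitutions with values 1, a, ∞ carry "exactly one letter in a class" across the identity,
and those with values 1, b, ∞ carry "at most one". Together they force the words of w(σ) to be
triples (`eval_subset_of_notMem`, `eval_subset_cycleTriples`). -/

/-! ### The algebra `S_(4,123)` -/

namespace S4123

instance : DecidableEq S4123 := fun x y => by
  cases x <;> cases y <;> first | exact isTrue rfl | exact isFalse (by intro h; cases h)

theorem isAISemiring : IsAISemiring S4123 where
  add_assoc x y z := by cases x <;> cases y <;> cases z <;> rfl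
  add_comm x y := by cases x <;> cases y <;> rfl
  add_idem x := by cases x <;> rfl
  mul_assoc x y z := by cases x <;> cases y <;> cases z <;> rfl
  add_mul x y z := by cases x <;> cases y <;> cases z <;> rfl
  mul_add x y z := by cases x <;> cases y <;> cases z <;> rfl

theorem add_eq_one {x y : S4123} : x + y = one ↔ x = one ∧ y = one := by
  cases x <;> cases y <;> decide

theorem add_eq_a {x y : S4123} : x + y = a ↔ x = a ∧ y = a := by
  cases x <;> cases y <;> decide

theorem mul_eq_one {x y : S4123} : x * y = one ↔ x = one ∧ y = one := by
  cases x <;> cases y <;> decide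

theorem mul_eq_a {x y : S4123} :
    x * y = a ↔ (x = one ∧ y = a) ∨ (x = a ∧ y = one) := by
  cases x <;> cases y <;> decide

/-- The elements below `b`. -/
def LeB (x : S4123) : Prop := x = one ∨ x = b

instance (x : S4123) : Decidable x.LeB := inferInstanceAs (Decidable (_ ∨ _))

theorem leB_add {x y : S4123} : (x + y).LeB ↔ x.LeB ∧ y.LeB := by
  cases x <;> cases y <;> decide

theorem leB_mul {x y : S4123} :
    (x * y).LeB ↔ (x = one ∧ y.LeB) ∨ (x.LeB ∧ y = one) := by
  cases x <;> cases y <;> decide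

end S4123

open S4123

/-! ### Sums of words of length three -/

theorem forall_eval_sum {X : Type*} {S : Type*} [Add S] [Mul S] {P : S → Prop}
    (hP : ∀ x y, P (x + y) ↔ P x ∧ P y) (φ : X → S) :
    ∀ (l : List (BTerm X)) (h : l ≠ []), P ((BTerm.sum l h).eval φ) ↔ ∀ t ∈ l, P (t.eval φ)
  | [], h => absurd rfl h
  | [t], _ => by simp [BTerm.sum]
  | t :: s :: l, _ => by
    rw [BTerm.sum, BTerm.eval, hP, forall_eval_sum hP φ (s :: l)]
    simp

/-- The sum is never `a` here. `∞` absorbs everything, value `1` forces all letters to be `1`, and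
value `b` forces all letters into {1, b}, which `b` absorbs. -/
theorem eval_sum_words_absorbs {X ι : Type*} (w : ι → X × X × X) (l : List ι)
    (hl : l.map (fun i => Hypergraph3.word (w i)) ≠ [])
    (φ : X → S4123)
    (hφ : ¬ ∀ i ∈ l, (φ (w i).1 * φ (w i).2.1) * φ (w i).2.2 = a)
    {i : ι} (hi : i ∈ l) :
    (BTerm.sum _ hl).eval φ = (BTerm.sum _ hl).eval φ + φ (w i).1 := by
  have h1 := forall_eval_sum (P := fun x => x = one) (fun _ _ => add_eq_one) φ _ hl
  have ha := forall_eval_sum (P := fun x => x = a) (fun _ _ => add_eq_a) φ _ hl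
  have hb := forall_eval_sum (P := LeB) (fun _ _ => leB_add) φ _ hl
  generalize (BTerm.sum _ hl).eval φ = s at h1 ha hb ⊢
  simp only [List.forall_mem_map, Hypergraph3.word, BTerm.eval] at h1 ha hb
  cases s with
  | inf => cases φ (w i).1 <;> rfl
  | a => exact absurd (ha.1 rfl) hφ
  | one =>
    have := h1.1 rfl i hi
    simp only [S4123.mul_eq_one] at this
    rw [this.1.1]; rfl
  | b =>
    have := hb.1 (Or.inr rfl) i hi
    simp only [leB_mul, S4123.mul_eq_one] at this
    have : (φ (w i).1).LeB := by
      rcases this with h | h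
      · exact Or.inl h.1.1
      · rcases h.1 with h | h
        · exact Or.inl h.1
        · exact h.1
    rcases this with h | h <;> rw [h] <;> rfl

theorem Hypergraph3.satisfies_of_not_twoColourable {V : Type} [Fintype V] (H : Hypergraph3 V)
    (hE : H.edges.Nonempty) (hV : H.NoIsolatedVertices) (hc : ¬ H.TwoColourable) (v : V) :
    Satisfies S4123 (H.term hE) (.add (H.term hE) (.var v)) := by
  classical
  intro φ
  obtain ⟨e, he, hve⟩ := hV v
  have hmem : ∃ p ∈ H.triples.toList, p.1 = v := by
    have h2 : (e.erase v).card = 2 := by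
      rw [Finset.card_erase_of_mem hve, H.card_edge e he]
    obtain ⟨y, z, -, hyz⟩ := Finset.card_eq_two.1 h2
    refine ⟨(v, y, z), ?_, rfl⟩
    have : ({v, y, z} : Finset V) = e := by rw [← hyz, Finset.insert_erase hve]
    simp only [Finset.mem_toList, triples, Finset.mem_filter, Finset.mem_univ, true_and]
    convert he
  obtain ⟨p, hp, rfl⟩ := hmem
  refine eval_sum_words_absorbs (fun p => p) H.triples.toList _ φ (fun hall => hc ?_) hp
  -- A word of value `a` has exactly one letter `a`, so colouring by "is `a`" takes both values on
  -- every hyperedge.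
  refine ⟨fun v => decide (φ v = a), fun e he => ?_⟩
  obtain ⟨x, y, z, -, -, -, rfl⟩ := Finset.card_eq_three.1 (H.card_edge e he)
  have h := hall (x, y, z) (by
    simp only [Finset.mem_toList, triples, Finset.mem_filter, Finset.mem_univ, true_and]
    convert he)
  simp only [mul_eq_a, S4123.mul_eq_one] at h
  rcases h with ⟨⟨h1, h2⟩, h3⟩ | ⟨⟨h1, h2⟩ | ⟨h1, h2⟩, h3⟩ <;>
    simp [Finset.image_insert, h1, h2, h3]

/-! ### Varieties and identities -/

theorem eval_hom {X S T : Type} [Add S] [Mul S] [Add T] [Mul T] {f : S → T} (hf : IsHom f)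
    (φ : X → S) (t : BTerm X) : f (t.eval φ) = t.eval (f ∘ φ) := by
  induction t with
  | var x => rfl
  | add s t hs ht => simp only [BTerm.eval, hf.1, hs, ht]
  | mul s t hs ht => simp only [BTerm.eval, hf.2, hs, ht]

theorem isVariety_satisfies {X : Type} (s t : BTerm X) :
    IsVariety {B : BAlg | Satisfies B s t} where
  sub B hB C f hf hinj φ := hinj <| by
    rw [eval_hom hf, eval_hom hf]; exact hB _
  image B hB C f hf hsurj φ := by
    have hφ : f ∘ (fun x => Function.surjInv hsurj (φ x)) = φ :=
      funext fun x => Function.surjInv_eq hsurj (φ x)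
    rw [← hφ, ← eval_hom hf, ← eval_hom hf]
    exact congrArg f (hB _)
  prod I B hB φ := by
    funext i
    have hi : IsHom (S := BAlg.pi B) (T := B i) (fun g => g i) :=
      ⟨fun _ _ => rfl, fun _ _ => rfl⟩
    have h := hB i ((fun g : BAlg.pi B => g i) ∘ φ)
    rw [← eval_hom hi, ← eval_hom hi] at h
    exact h

namespace BTerm

/-- Renaming of variables. -/
def map {X Y : Type*} (f : X → Y) : BTerm X → BTerm Y
  | var x => var (f x)
  | add s t => add (map f s) (map f t)
  | mul s t => mul (map f s) (map f t)

theorem eval_map {X Y S : Type*} [Add S] [Mul S] (f : X → Y) (φ : Y → S) (t : BTerm X) :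
    (t.map f).eval φ = t.eval (φ ∘ f) := by
  induction t with
  | var x => rfl
  | add s t hs ht => simp only [map, eval, hs, ht]
  | mul s t hs ht => simp only [map, eval, hs, ht]

/-- The variables of a term, with repetitions. -/
def leaves {X : Type*} : BTerm X → List X
  | var x => [x]
  | add s t => leaves s ++ leaves t
  | mul s t => leaves s ++ leaves t

theorem length_leaves_map {X Y : Type*} (f : X → Y) (t : BTerm X) :
    (t.map f).leaves.length = t.leaves.length := by
  induction t with
  | var x => rfl
  | add s t hs ht => simp [map, leaves, hs, ht]
  | mul s t hs ht => simp [map, leaves, hs, ht]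

end BTerm

/-! ### Nonempty languages of commutative words -/

/-- A nonempty set of commutative words. -/
structure Lang (V : Type*) where
  words : Set (Multiset V)
  nonempty : words.Nonempty

namespace Lang

variable {V X : Type*}

instance : Add (Lang V) := ⟨fun A B => ⟨A.words ∪ B.words, A.nonempty.inl⟩⟩

instance : Mul (Lang V) :=
  ⟨fun A B => ⟨Set.image2 (· + ·) A.words B.words, A.nonempty.image2 B.nonempty⟩⟩

theorem mem_add {A B : Lang V} {q : Multiset V} :
    q ∈ (A + B).words ↔ q ∈ A.words ∨ q ∈ B.words := Iff.rfl

theorem forall_mem_add {A B : Lang V} {P : Multiset V → Prop} :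
    (∀ q ∈ (A + B).words, P q) ↔ (∀ q ∈ A.words, P q) ∧ ∀ q ∈ B.words, P q := by
  simp only [mem_add, or_imp, forall_and]

theorem forall_mem_mul {A B : Lang V} {P : Multiset V → Prop} :
    (∀ q ∈ (A * B).words, P q) ↔ ∀ x ∈ A.words, ∀ y ∈ B.words, P (x + y) :=
  Set.forall_mem_image2

/-! ### Letter counts on products, and their transfer along identities -/

theorem forall_add_eq_zero (κ : Multiset V →+ ℕ) (A B : Lang V) :
    (∀ x ∈ A.words, ∀ y ∈ B.words, κ (x + y) = 0) ↔
      (∀ x ∈ A.words, κ x = 0) ∧ ∀ y ∈ B.words, κ y = 0 := by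
  obtain ⟨x₀, hx₀⟩ := A.nonempty
  obtain ⟨y₀, hy₀⟩ := B.nonempty
  simp only [map_add, Nat.add_eq_zero_iff]
  exact ⟨fun h => ⟨fun x hx => (h x hx y₀ hy₀).1, fun y hy => (h x₀ hx₀ y hy).2⟩,
    fun h x hx y hy => ⟨h.1 x hx, h.2 y hy⟩⟩

theorem forall_add_eq_one (κ : Multiset V →+ ℕ) (A B : Lang V) :
    (∀ x ∈ A.words, ∀ y ∈ B.words, κ (x + y) = 1) ↔
      ((∀ x ∈ A.words, κ x = 0) ∧ ∀ y ∈ B.words, κ y = 1) ∨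
      ((∀ x ∈ A.words, κ x = 1) ∧ ∀ y ∈ B.words, κ y = 0) := by
  obtain ⟨x₀, hx₀⟩ := A.nonempty
  obtain ⟨y₀, hy₀⟩ := B.nonempty
  simp only [map_add]
  constructor
  · intro h
    have h0 := h x₀ hx₀ y₀ hy₀
    rcases Nat.eq_zero_or_pos (κ x₀) with h1 | h1
    · refine Or.inl ⟨fun x hx => ?_, fun y hy => ?_⟩
      · have := h x hx y₀ hy₀; omega
      · have := h x₀ hx₀ y hy; omega
    · refine Or.inr ⟨fun x hx => ?_, fun y hy => ?_⟩
      · have := h x hx y₀ hy₀; omega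
      · have := h x₀ hx₀ y hy; omega
  · rintro (⟨h1, h2⟩ | ⟨h1, h2⟩) x hx y hy <;> rw [h1 x hx, h2 y hy]

theorem forall_add_le_one (κ : Multiset V →+ ℕ) (A B : Lang V) :
    (∀ x ∈ A.words, ∀ y ∈ B.words, κ (x + y) ≤ 1) ↔
      ((∀ x ∈ A.words, κ x = 0) ∧ ∀ y ∈ B.words, κ y ≤ 1) ∨
      ((∀ x ∈ A.words, κ x ≤ 1) ∧ ∀ y ∈ B.words, κ y = 0) := by
  simp only [map_add]
  constructor
  · intro h
    by_cases hA : ∀ x ∈ A.words, κ x = 0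
    · obtain ⟨x₀, hx₀⟩ := A.nonempty
      exact Or.inl ⟨hA, fun y hy => by have := h x₀ hx₀ y hy; omega⟩
    · push Not at hA
      obtain ⟨x₀, hx₀, hne⟩ := hA
      obtain ⟨y₀, hy₀⟩ := B.nonempty
      refine Or.inr ⟨fun x hx => ?_, fun y hy => ?_⟩
      · have := h x hx y₀ hy₀; omega
      · have := h x₀ hx₀ y hy; omega
  · rintro (⟨h1, h2⟩ | ⟨h1, h2⟩) x hx y hy
    · have := h1 x hx; have := h2 y hy; omega
    · have := h1 x hx; have := h2 y hy; omega

open Classical in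
-- The substitution `ψ` records whether κ is constantly 0 (value `1`), constantly 1 (value `a`), or
-- neither (`∞`). The tables of `S4123` propagate exactly this information, so an identity preserves
-- it. Nonemptiness of languages keeps the first two cases apart.
theorem forall_eq_one_of_satisfies (κ : Multiset V →+ ℕ) (σ : X → Lang V) {u w : BTerm X}
    (h : Satisfies S4123 u w) (hu : ∀ q ∈ (u.eval σ).words, κ q = 1) :
    ∀ q ∈ (w.eval σ).words, κ q = 1 := by
  let ψ : X → S4123 := fun y =>
    if ∀ q ∈ (σ y).words, κ q = 0 then one else if ∀ q ∈ (σ y).words, κ q = 1 then a else inf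
  have key (t : BTerm X) : (t.eval ψ = one ↔ ∀ q ∈ (t.eval σ).words, κ q = 0) ∧
      (t.eval ψ = a ↔ ∀ q ∈ (t.eval σ).words, κ q = 1) := by
    induction t with
    | var y =>
      obtain ⟨q₀, hq₀⟩ := (σ y).nonempty
      have hne : (∀ q ∈ (σ y).words, κ q = 0) → ¬ ∀ q ∈ (σ y).words, κ q = 1 :=
        fun h0 h1 => by simpa [h0 q₀ hq₀] using h1 q₀ hq₀
      simp only [BTerm.eval, ψ]
      split_ifs with h0 h1 <;> simp_all
    | add s t hs ht =>
      simp only [BTerm.eval, add_eq_one, add_eq_a, forall_mem_add, hs, ht, and_self]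
    | mul s t hs ht =>
      simp only [BTerm.eval, S4123.mul_eq_one, mul_eq_a, forall_mem_mul, forall_add_eq_zero,
        forall_add_eq_one, hs, ht, and_self]
  rw [← (key w).2, ← h ψ, (key u).2]
  exact hu

open Classical in
-- The same device with `b` in place of `a`: a product of languages has κ ≤ 1 only if κ vanishes on
-- one factor.
theorem forall_le_one_of_satisfies (κ : Multiset V →+ ℕ) (σ : X → Lang V) {u w : BTerm X}
    (h : Satisfies S4123 u w) (hu : ∀ q ∈ (u.eval σ).words, κ q ≤ 1) :
    ∀ q ∈ (w.eval σ).words, κ q ≤ 1 := by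
  let ψ : X → S4123 := fun y =>
    if ∀ q ∈ (σ y).words, κ q = 0 then one else if ∀ q ∈ (σ y).words, κ q ≤ 1 then b else inf
  have key (t : BTerm X) : (t.eval ψ = one ↔ ∀ q ∈ (t.eval σ).words, κ q = 0) ∧
      ((t.eval ψ).LeB ↔ ∀ q ∈ (t.eval σ).words, κ q ≤ 1) := by
    induction t with
    | var y =>
      have hle : (∀ q ∈ (σ y).words, κ q = 0) → ∀ q ∈ (σ y).words, κ q ≤ 1 :=
        fun h0 q hq => by simp [h0 q hq]
      simp only [BTerm.eval, ψ]
      split_ifs with h0 h1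
      · exact ⟨iff_of_true rfl h0, iff_of_true (Or.inl rfl) (hle h0)⟩
      · exact ⟨iff_of_false (by decide) h0, iff_of_true (Or.inr rfl) h1⟩
      · exact ⟨iff_of_false (by decide) h0, iff_of_false (by decide) h1⟩
    | add s t hs ht =>
      simp only [BTerm.eval, add_eq_one, leB_add, forall_mem_add, hs, ht, and_self]
    | mul s t hs ht =>
      simp only [BTerm.eval, S4123.mul_eq_one, leB_mul, forall_mem_mul, forall_add_eq_zero,
        forall_add_le_one, hs, ht, and_self]
  rw [← (key w).2, ← h ψ, (key u).2]
  exact hu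

/-! ### The syntactic algebra, and how words of a term depend on the substitution -/

/-- The words `q` whose product with every word of `A` lies in `L`. -/
def residual (L : Set (Multiset V)) (A : Lang V) : Set (Multiset V) :=
  {p | ∀ q ∈ A.words, p + q ∈ L}

theorem residual_add (L : Set (Multiset V)) (A B : Lang V) :
    residual L (A + B) = residual L A ∩ residual L B := by
  ext p; exact forall_mem_add

theorem mem_residual_mul {L : Set (Multiset V)} {A B : Lang V} {p : Multiset V} :
    p ∈ residual L (A * B) ↔ ∀ x ∈ A.words, p + x ∈ residual L B := by
  simp only [residual, Set.mem_ofPred_eq, forall_mem_mul, add_assoc]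

theorem mem_residual_mul' {L : Set (Multiset V)} {A B : Lang V} {p : Multiset V} :
    p ∈ residual L (A * B) ↔ ∀ y ∈ B.words, p + y ∈ residual L A := by
  simp only [residual, Set.mem_ofPred_eq, forall_mem_mul, add_assoc]
  exact ⟨fun h y hy x hx => by rw [add_comm y]; exact h x hx y hy,
    fun h x hx y hy => by rw [add_comm x]; exact h y hy x hx⟩

/-- Languages with the same residual are identified. -/
def syntacticSetoid (L : Set (Multiset V)) : Setoid (Lang V) :=
  Setoid.ker (residual L)

/-- The syntactic algebra of a set of commutative words. -/
def Syntactic (L : Set (Multiset V)) : Type _ := Quotient (syntacticSetoid L)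

instance (L : Set (Multiset V)) : Nonempty (Syntactic L) := ⟨⟦⟨{0}, ⟨0, rfl⟩⟩⟧⟩

instance (L : Set (Multiset V)) : Add (Syntactic L) :=
  ⟨Quotient.map₂ (· + ·) fun A A' hA B B' hB => by
    change residual L _ = residual L _
    rw [residual_add, residual_add, show residual L A = residual L A' from hA,
      show residual L B = residual L B' from hB]⟩

instance (L : Set (Multiset V)) : Mul (Syntactic L) :=
  ⟨Quotient.map₂ (· * ·) fun A A' hA B B' hB => by
    change residual L (A * B) = residual L (A' * B')
    ext p
    rw [mem_residual_mul, show residual L B = residual L B' from hB, ← mem_residual_mul,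
      mem_residual_mul', show residual L A = residual L A' from hA, ← mem_residual_mul']⟩

/-- The class of a language in the syntactic algebra. -/
def toSyntactic (L : Set (Multiset V)) (A : Lang V) : Syntactic L :=
  Quotient.mk (syntacticSetoid L) A

theorem toSyntactic_eq_iff {L : Set (Multiset V)} {A B : Lang V} :
    toSyntactic L A = toSyntactic L B ↔ residual L A = residual L B :=
  Quotient.eq (r := syntacticSetoid L)

theorem toSyntactic_eval (L : Set (Multiset V)) (σ : X → Lang V) (t : BTerm X) :
    toSyntactic L (t.eval σ) = t.eval (toSyntactic L ∘ σ) := by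
  induction t with
  | var x => rfl
  | add s t hs ht => simp only [BTerm.eval, ← hs, ← ht]; rfl
  | mul s t hs ht => simp only [BTerm.eval, ← hs, ← ht]; rfl

/-- Fix an occurrence of y and choose arbitrary words for the factors multiplied with it. Their
product p does not depend on the word chosen for y. -/
theorem exists_complement (σ : X → Lang V) (u : BTerm X) :
    ∀ y ∈ u.leaves, ∃ p, ∀ q ∈ (σ y).words, p + q ∈ (u.eval σ).words := by
  induction u with
  | var x =>
    intro y hy
    obtain rfl : y = x := by simpa [BTerm.leaves] using hy
    exact ⟨0, fun q hq => by simpa [BTerm.eval] using hq⟩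
  | add s t hs ht =>
    intro y hy
    rcases List.mem_append.1 hy with hy | hy
    · obtain ⟨p, hp⟩ := hs y hy
      exact ⟨p, fun q hq => Or.inl (hp q hq)⟩
    · obtain ⟨p, hp⟩ := ht y hy
      exact ⟨p, fun q hq => Or.inr (hp q hq)⟩
  | mul s t hs ht =>
    intro y hy
    rcases List.mem_append.1 hy with hy | hy
    · obtain ⟨p, hp⟩ := hs y hy
      obtain ⟨r, hr⟩ := (t.eval σ).nonempty
      exact ⟨p + r, fun q hq => ⟨p + q, hp q hq, r, hr, add_right_comm p q r⟩⟩
    · obtain ⟨p, hp⟩ := ht y hy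
      obtain ⟨r, hr⟩ := (s.eval σ).nonempty
      exact ⟨r + p, fun q hq => ⟨r, hr, p + q, hp q hq, (add_assoc r p q).symm⟩⟩

theorem notMem_of_mem_eval {σ : X → Lang V} {c : V} (u : BTerm X)
    (h : ∀ y ∈ u.leaves, ∀ q ∈ (σ y).words, c ∉ q) : ∀ q ∈ (u.eval σ).words, c ∉ q := by
  induction u with
  | var x => exact h x (by simp [BTerm.leaves])
  | add s t hs ht =>
    simp only [BTerm.leaves, List.mem_append, or_imp, forall_and] at h
    exact forall_mem_add.2 ⟨hs h.1, ht h.2⟩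
  | mul s t hs ht =>
    simp only [BTerm.leaves, List.mem_append, or_imp, forall_and] at h
    refine forall_mem_mul.2 fun x hx y hy => ?_
    rw [Multiset.mem_add, not_or]
    exact ⟨hs h.1 x hx, ht h.2 y hy⟩

theorem exists_related_eval {R : Multiset V → Multiset V → Prop}
    (hR : ∀ p p' q q', R p p' → R q q' → R (p + q) (p' + q')) {σ σ' : X → Lang V}
    (h : ∀ y, ∀ q ∈ (σ y).words, ∃ q' ∈ (σ' y).words, R q q') (u : BTerm X) :
    ∀ q ∈ (u.eval σ).words, ∃ q' ∈ (u.eval σ').words, R q q' := by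
  induction u with
  | var x => exact h x
  | add s t hs ht =>
    refine forall_mem_add.2 ⟨fun q hq => ?_, fun q hq => ?_⟩
    · obtain ⟨q', hq', hr⟩ := hs q hq
      exact ⟨q', Or.inl hq', hr⟩
    · obtain ⟨q', hq', hr⟩ := ht q hq
      exact ⟨q', Or.inr hq', hr⟩
  | mul s t hs ht =>
    refine forall_mem_mul.2 fun x hx y hy => ?_
    obtain ⟨x', hx', hr⟩ := hs x hx
    obtain ⟨y', hy', hr'⟩ := ht y hy
    exact ⟨x' + y', ⟨x', hx', y', hy', rfl⟩, hR _ _ _ _ hr hr'⟩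

end Lang

/-! ### Consecutive triples in a cycle -/

/-- The commutative words `x_i x_{i+1} x_{i+2}` over the cycle of length `n`. -/
def cycleTriples (n : ℕ) : Set (Multiset (ZMod n)) :=
  {q | ∃ i, q = {i, i + 1, i + 2}}

theorem card_of_mem_cycleTriples {n : ℕ} {q : Multiset (ZMod n)} (h : q ∈ cycleTriples n) :
    Multiset.card q = 3 := by
  obtain ⟨i, rfl⟩ := h; rfl

theorem natCast_zmod_ne_zero {n k : ℕ} (hk : 0 < k) (hn : k < n) : (k : ZMod n) ≠ 0 := by
  rw [Ne, ZMod.natCast_eq_zero_iff]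
  exact Nat.not_dvd_of_pos_of_lt hk hn

/-- Two positions of the cycle at distance one or two. -/
def CycleAdj {n : ℕ} (x y : ZMod n) : Prop :=
  y = x + 1 ∨ y = x + 2 ∨ x = y + 1 ∨ x = y + 2

/-- Distinct positions in a triple are adjacent. The case x = y is included, and later excludes
repeated letters. -/
theorem countP_pair_le_one {n : ℕ} (hn : 7 ≤ n) {x y : ZMod n} (h : ¬ CycleAdj x y)
    {e : Multiset (ZMod n)} (he : e ∈ cycleTriples n) :
    e.countP (fun j => j = x ∨ j = y) ≤ 1 := by
  obtain ⟨i, rfl⟩ := he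
  have h1 : (1 : ZMod n) ≠ 0 := by
    exact_mod_cast natCast_zmod_ne_zero (n := n) (k := 1) (by omega) (by omega)
  have h2 : (2 : ZMod n) ≠ 0 := by
    exact_mod_cast natCast_zmod_ne_zero (n := n) (k := 2) (by omega) (by omega)
  simp only [CycleAdj, not_or] at h
  simp only [Multiset.insert_eq_cons, Multiset.countP_cons, ← Multiset.cons_zero,
    Multiset.countP_zero]
  grind

/-- Differences are ±1 or ±2, and n ≥ 7 excludes wrapping around, as for 0, 2, 4 modulo 6. -/
theorem triple_mem_cycleTriples {n : ℕ} (hn : 7 ≤ n) {x y z : ZMod n} (hxy : CycleAdj x y)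
    (hxz : CycleAdj x z) (hyz : CycleAdj y z) :
    ({x, y, z} : Multiset (ZMod n)) ∈ cycleTriples n := by
  have h (k : ℕ) (hk : 0 < k) (hk' : k < 7) : (k : ZMod n) ≠ 0 :=
    natCast_zmod_ne_zero hk (by omega)
  have h1 : (1 : ZMod n) ≠ 0 := by exact_mod_cast h 1 (by omega) (by omega)
  have h2 : (2 : ZMod n) ≠ 0 := by exact_mod_cast h 2 (by omega) (by omega)
  have h3 : (3 : ZMod n) ≠ 0 := by exact_mod_cast h 3 (by omega) (by omega)
  have h4 : (4 : ZMod n) ≠ 0 := by exact_mod_cast h 4 (by omega) (by omega)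
  have h5 : (5 : ZMod n) ≠ 0 := by exact_mod_cast h 5 (by omega) (by omega)
  have h6 : (6 : ZMod n) ≠ 0 := by exact_mod_cast h 6 (by omega) (by omega)
  have key : (y = x + 1 ∧ z = x + 2) ∨ (z = x + 1 ∧ y = x + 2) ∨ (x = y + 1 ∧ z = y + 2) ∨
      (z = y + 1 ∧ x = y + 2) ∨ (x = z + 1 ∧ y = z + 2) ∨ (y = z + 1 ∧ x = z + 2) := by
    simp only [CycleAdj] at hxy hxz hyz
    grind
  have s1 (p q r : ZMod n) : ({p, q, r} : Multiset (ZMod n)) = {q, p, r} :=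
    Multiset.cons_swap _ _ _
  have s2 (p q r : ZMod n) : ({p, q, r} : Multiset (ZMod n)) = {p, r, q} :=
    congrArg (Multiset.cons p) (Multiset.pair_comm _ _)
  rcases key with ⟨h, h'⟩ | ⟨h, h'⟩ | ⟨h, h'⟩ | ⟨h, h'⟩ | ⟨h, h'⟩ | ⟨h, h'⟩
  · exact ⟨x, by rw [h, h']⟩
  · exact ⟨x, by rw [s2, h, h']⟩
  · exact ⟨y, by rw [s1, h, h']⟩
  · exact ⟨y, by rw [s1, s2, h, h']⟩
  · exact ⟨z, by rw [s2, s1, h, h']⟩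
  · exact ⟨z, by rw [s2, s1, s2, h, h']⟩

/-- A triple avoiding c does not cross the cut at c, so its distances from c are three consecutive
natural numbers. -/
theorem countP_mod_three {n : ℕ} [NeZero n] {c : ZMod n} {e : Multiset (ZMod n)}
    (he : e ∈ cycleTriples n) (hc : c ∉ e) {r : ℕ} (hr : r < 3) :
    e.countP (fun j => (j - c).val % 3 = r) = 1 := by
  obtain ⟨i, rfl⟩ := he
  have hlt := ZMod.val_lt (i - c)
  obtain ⟨m, hm⟩ : ∃ m, (i - c).val = m := ⟨_, rfl⟩
  have him : i - c = (m : ZMod n) := by rw [← hm, ZMod.natCast_zmod_val]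
  simp only [Multiset.insert_eq_cons, Multiset.mem_cons, Multiset.mem_singleton, not_or] at hc
  have h1 : m + 1 ≠ n := fun h => hc.2.1 <| by
    have : ((m + 1 : ℕ) : ZMod n) = 0 := by rw [h, ZMod.natCast_self]
    push_cast at this
    linear_combination -this - him
  have h2 : m + 2 ≠ n := fun h => hc.2.2 <| by
    have : ((m + 2 : ℕ) : ZMod n) = 0 := by rw [h, ZMod.natCast_self]
    push_cast at this
    linear_combination -this - him
  have e1 : i + 1 - c = ((m + 1 : ℕ) : ZMod n) := by push_cast; linear_combination him
  have e2 : i + 2 - c = ((m + 2 : ℕ) : ZMod n) := by push_cast; linear_combination him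
  have v1 : (i + 1 - c).val = m + 1 := by rw [e1, ZMod.val_natCast_of_lt (by omega)]
  have v2 : (i + 2 - c).val = m + 2 := by rw [e2, ZMod.val_natCast_of_lt (by omega)]
  simp only [Multiset.insert_eq_cons, Multiset.countP_cons, ← Multiset.cons_zero,
    Multiset.countP_zero, hm, v1, v2]
  split_ifs <;> omega

theorem card_eq_sum_countP_mod_three {V : Type*} (f : V → ℕ) (q : Multiset V) :
    Multiset.card q = q.countP (fun j => f j % 3 = 0) + q.countP (fun j => f j % 3 = 1) +
      q.countP (fun j => f j % 3 = 2) := by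
  induction q using Multiset.induction with
  | empty => simp
  | cons x q ih =>
    simp only [Multiset.card_cons, Multiset.countP_cons, ih]
    split_ifs <;> omega

/-! ### Short identities preserve inclusion in the cycle language -/

open Lang in
-- The three mod-3 classes force length 3, and the pair counts force the letters to be pairwise
-- adjacent.
theorem eval_subset_of_notMem {X : Type*} {n : ℕ} (hn : 7 ≤ n) {u w : BTerm X}
    (h : Satisfies S4123 u w) (σ : X → Lang (ZMod n)) (c : ZMod n)
    (hu : (u.eval σ).words ⊆ cycleTriples n) (hc : ∀ q ∈ (u.eval σ).words, c ∉ q) :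
    (w.eval σ).words ⊆ cycleTriples n := by
  have : NeZero n := ⟨by omega⟩
  intro q hq
  have hcount (r : ℕ) (hr : r < 3) : q.countP (fun j => (j - c).val % 3 = r) = 1 :=
    forall_eq_one_of_satisfies (Multiset.countPAddMonoidHom _) σ h
      (fun e he => countP_mod_three (hu he) (hc e he) hr) q hq
  have hadj (x y : ZMod n) (h2 : 2 ≤ q.countP (fun j => j = x ∨ j = y)) : CycleAdj x y := by
    by_contra hxy
    have := forall_le_one_of_satisfies (Multiset.countPAddMonoidHom _) σ h
      (fun e he => countP_pair_le_one hn hxy (hu he)) q hq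
    exact absurd h2 (not_le.2 (Nat.lt_succ_of_le this))
  have hcard : Multiset.card q = 3 := by
    rw [card_eq_sum_countP_mod_three (fun j => (j - c).val), hcount 0 (by omega),
      hcount 1 (by omega), hcount 2 (by omega)]
  obtain ⟨x, y, z, rfl⟩ := Multiset.card_eq_three.1 hcard
  refine triple_mem_cycleTriples hn (hadj _ _ ?_) (hadj _ _ ?_) (hadj _ _ ?_) <;>
    simp [Multiset.insert_eq_cons, Multiset.countP_cons, ← Multiset.cons_zero]

open Lang Classical in
theorem eval_subset_cycleTriples {X : Type*} {n : ℕ} {u w : BTerm X}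
    (h : Satisfies S4123 u w) (hn : 7 ≤ n) (hlen : 5 * u.leaves.length < n)
    (σ : X → Lang (ZMod n)) (hu : (u.eval σ).words ⊆ cycleTriples n) :
    (w.eval σ).words ⊆ cycleTriples n := by
  have : NeZero n := ⟨by omega⟩
  have hF (y : X) : ∃ F : Finset (ZMod n), F.card ≤ 5 ∧ (y ∈ u.leaves →
      ∀ q ∈ (σ y).words, q ∈ cycleTriples n ∨ ∀ j ∈ q, j ∈ F) := by
    by_cases hy : y ∈ u.leaves
    swap
    · exact ⟨∅, by simp, fun h => absurd h hy⟩
    obtain ⟨p, hp⟩ := exists_complement σ u y hy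
    rcases p.empty_or_exists_mem with rfl | ⟨k, hk⟩
    · exact ⟨∅, by simp, fun _ q hq => Or.inl (by simpa using hu (hp q hq))⟩
    -- These are the only positions that can share a triple with k.
    · refine ⟨{k - 2, k - 1, k, k + 1, k + 2}, Finset.card_le_five, fun _ q hq => Or.inr ?_⟩
      intro j hj
      obtain ⟨i, hi⟩ := hu (hp q hq)
      have hk' : k ∈ p + q := Multiset.mem_add.2 (Or.inl hk)
      have hj' : j ∈ p + q := Multiset.mem_add.2 (Or.inr hj)
      simp only [hi, Multiset.insert_eq_cons, Multiset.mem_cons, Multiset.mem_singleton]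
        at hk' hj'
      simp only [Finset.mem_insert, Finset.mem_singleton]
      grind
  choose F hFcard hF using hF
  obtain ⟨c, hc⟩ : ∃ c, c ∉ u.leaves.toFinset.biUnion F := by
    by_contra! hall
    have h1 : (u.leaves.toFinset.biUnion F).card = n := by
      rw [Finset.eq_univ_iff_forall.2 hall, Finset.card_univ, ZMod.card]
    have h2 := Finset.card_biUnion_le_card_mul u.leaves.toFinset F 5 fun y _ => hFcard y
    have h3 := u.leaves.toFinset_card_le
    omega
  simp only [Finset.mem_biUnion, List.mem_toFinset, not_exists, not_and] at hc
  let e : Multiset (ZMod n) := {c + 1, c + 1 + 1, c + 1 + 2}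
  have he : e ∈ cycleTriples n := ⟨c + 1, rfl⟩
  have hce : c ∉ e := by
    have h1 : (1 : ZMod n) ≠ 0 := by
      exact_mod_cast natCast_zmod_ne_zero (n := n) (k := 1) (by omega) (by omega)
    have h2 : (2 : ZMod n) ≠ 0 := by
      exact_mod_cast natCast_zmod_ne_zero (n := n) (k := 2) (by omega) (by omega)
    have h3 : (3 : ZMod n) ≠ 0 := by
      exact_mod_cast natCast_zmod_ne_zero (n := n) (k := 3) (by omega) (by omega)
    simp only [e, Multiset.insert_eq_cons, Multiset.mem_cons, Multiset.mem_singleton]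
    rintro (h | h | h)
    · exact h1 (by linear_combination -h)
    · exact h2 (by linear_combination -h)
    · exact h3 (by linear_combination -h)
  -- Full triples are the only values not confined to the sets `F`; all are moved to the one triple
  -- `e`, which avoids c.
  let τ : Multiset (ZMod n) → Multiset (ZMod n) := fun q => if q ∈ cycleTriples n then e else q
  let σ' : X → Lang (ZMod n) := fun y => ⟨τ '' (σ y).words, (σ y).nonempty.image τ⟩
  -- `R` is compatible with products. For words of length 3, its second case says that q is itself a
  -- triple and q' = e, so membership in the cycle language passes both ways.
  let R : Multiset (ZMod n) → Multiset (ZMod n) → Prop := fun q q' =>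
    q = q' ∨ Multiset.card q = Multiset.card q' ∧ (∃ d ∈ cycleTriples n, d ≤ q) ∧ e ≤ q'
  have hR (p p' q q') (h : R p p') (h' : R q q') : R (p + q) (p' + q') := by
    rcases h with rfl | ⟨h1, ⟨d, hd, hdp⟩, h2⟩
    · rcases h' with rfl | ⟨h1, ⟨d, hd, hdp⟩, h2⟩
      · exact Or.inl rfl
      · exact Or.inr ⟨by simp [h1], ⟨d, hd, le_add_left hdp⟩, le_add_left h2⟩
    · have hcard : Multiset.card q = Multiset.card q' := by
        rcases h' with rfl | h'
        exacts [rfl, h'.1]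
      exact Or.inr ⟨by simp [h1, hcard], ⟨d, hd, le_add_right hdp⟩, le_add_right h2⟩
  have hτ (q) : R q (τ q) := by
    by_cases hq : q ∈ cycleTriples n
    · exact Or.inr ⟨by simp only [τ, if_pos hq, card_of_mem_cycleTriples hq,
        card_of_mem_cycleTriples he], ⟨q, hq, le_rfl⟩, by simp [τ, if_pos hq]⟩
    · exact Or.inl (by simp [τ, if_neg hq])
  have hu' : (u.eval σ').words ⊆ cycleTriples n := by
    intro q' hq'
    obtain ⟨q, hq, hr⟩ := exists_related_eval (R := fun q' q => R q q')
      (fun p p' q q' => hR p' p q' q) (σ := σ') (σ' := σ)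
      (fun y => Set.forall_mem_image.2 fun q hq => ⟨q, hq, hτ q⟩) u q' hq'
    rcases hr with rfl | ⟨h1, -, h2⟩
    · exact hu hq
    · rwa [← Multiset.eq_of_le_of_card_le h2 (by
        rw [← h1, card_of_mem_cycleTriples (hu hq), card_of_mem_cycleTriples he])]
  have hcu : ∀ q ∈ (u.eval σ').words, c ∉ q := by
    refine notMem_of_mem_eval u fun y hy => Set.forall_mem_image.2 fun q hq => ?_
    by_cases hq' : q ∈ cycleTriples n
    · simpa only [τ, if_pos hq'] using hce
    · simp only [τ, if_neg hq']
      exact fun hcq => hc y hy (((hF y hy q hq).resolve_left hq') c hcq)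
  have hw := eval_subset_of_notMem hn h σ' c hu' hcu
  intro q hq
  obtain ⟨q', hq', hr⟩ := exists_related_eval hR (σ := σ) (σ' := σ')
    (fun y q hq => ⟨τ q, ⟨q, hq, rfl⟩, hτ q⟩) w q hq
  rcases hr with rfl | ⟨h1, ⟨d, hd, hdq⟩, -⟩
  · exact hw hq'
  · rwa [← Multiset.eq_of_le_of_card_le hdq (by
      rw [h1, card_of_mem_cycleTriples (hw hq'), card_of_mem_cycleTriples hd])]

theorem residual_eval_subset {n : ℕ} {u w : BTerm ℕ} (h : Satisfies S4123 u w) (hn : 7 ≤ n)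
    (hlen : 5 * (u.leaves.length + 1) < n) (σ : ℕ → Lang (ZMod n)) :
    Lang.residual (cycleTriples n) (u.eval σ) ⊆ Lang.residual (cycleTriples n) (w.eval σ) := by
  intro p hp
  -- A fresh variable with value p turns membership in a residual into inclusion of a product; it
  -- costs one leaf, hence the `+ 1`.
  let σ' : Option ℕ → Lang (ZMod n) := fun o => o.elim ⟨{p}, ⟨p, rfl⟩⟩ σ
  have hσ (t : BTerm ℕ) : ((BTerm.mul (.var none) (t.map some)).eval σ').words ⊆ cycleTriples n ↔
      p ∈ Lang.residual (cycleTriples n) (t.eval σ) := by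
    change (∀ q ∈ _, _) ↔ _
    rw [BTerm.eval, BTerm.eval_map, Lang.forall_mem_mul]
    exact ⟨fun h => h p rfl, fun h x hx => by rw [show x = p from hx]; exact h⟩
  rw [← hσ] at hp ⊢
  refine eval_subset_cycleTriples (fun φ => ?_) hn ?_ σ' hp
  · simp only [BTerm.eval, BTerm.eval_map, h _]
  · rw [BTerm.leaves, List.length_append, BTerm.length_leaves_map, add_comm]
    exact hlen

theorem syntactic_satisfies {n : ℕ} {u w : BTerm ℕ} (h : Satisfies S4123 u w) (hn : 7 ≤ n)
    (hu : 5 * (u.leaves.length + 1) < n) (hw : 5 * (w.leaves.length + 1) < n) :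
    Satisfies (Lang.Syntactic (cycleTriples n)) u w := by
  intro φ
  have hφ : φ = Lang.toSyntactic _ ∘ fun x => (φ x).out :=
    funext fun x => (Quotient.out_eq (φ x)).symm
  rw [hφ, ← Lang.toSyntactic_eval, ← Lang.toSyntactic_eval, Lang.toSyntactic_eq_iff]
  exact (residual_eval_subset h hn hu _).antisymm
    (residual_eval_subset (fun ψ => (h ψ).symm) hn hw _)

/-! ### The separating identity -/

/-- The sum of the words `x_i x_{i+1} x_{i+2}` over the cycle of length `n`. -/
noncomputable def cycleTerm (n : ℕ) [NeZero n] : BTerm (ZMod n) :=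
  BTerm.sum ((Finset.univ : Finset (ZMod n)).toList.map
    fun i => Hypergraph3.word (i, i + 1, i + 2)) (by simp [Finset.univ_nonempty.ne_empty])

theorem satisfies_cycleTerm {n : ℕ} [NeZero n] (hn : ¬ 3 ∣ n) :
    Satisfies S4123 (cycleTerm n) (.add (cycleTerm n) (.var 0)) := by
  intro φ
  refine eval_sum_words_absorbs (fun i : ZMod n => (i, i + 1, i + 2)) Finset.univ.toList _ φ
    (fun hall => hn ?_) (i := 0) (by simp)
  -- Each triple has exactly one `a`; summing over all triples counts every `a` three times, so n =
  -- 3 ∑ f.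
  let f : ZMod n → ℕ := fun i => if φ i = a then 1 else 0
  have hf (i : ZMod n) : f i + f (i + 1) + f (i + 2) = 1 := by
    have h := hall i (by simp)
    simp only [mul_eq_a, S4123.mul_eq_one] at h
    rcases h with ⟨⟨h1, h2⟩, h3⟩ | ⟨⟨h1, h2⟩ | ⟨h1, h2⟩, h3⟩ <;> simp [f, h1, h2, h3]
  have hshift (k : ZMod n) : ∑ i, f (i + k) = ∑ i, f i :=
    Equiv.sum_comp (Equiv.addRight k) f
  have hsum : ∑ i, (f i + f (i + 1) + f (i + 2)) = n := by simp [hf, ZMod.card]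
  rw [Finset.sum_add_distrib, Finset.sum_add_distrib, hshift, hshift] at hsum
  exact ⟨∑ i, f i, by omega⟩

/-- With each variable sent to its own letter, the empty word lies in the residual of the cycle
term, but not after adding a one-letter word. -/
theorem syntactic_not_satisfies {n : ℕ} [NeZero n] :
    ¬ Satisfies (Lang.Syntactic (cycleTriples n)) (cycleTerm n)
      (.add (cycleTerm n) (.var 0)) := by
  intro h
  let σ : ZMod n → Lang (ZMod n) := fun i => ⟨{{i}}, ⟨{i}, rfl⟩⟩
  have h := h (Lang.toSyntactic _ ∘ σ)
  rw [← Lang.toSyntactic_eval, ← Lang.toSyntactic_eval, Lang.toSyntactic_eq_iff] at h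
  have h0 : (0 : Multiset (ZMod n)) ∈ Lang.residual (cycleTriples n) ((cycleTerm n).eval σ) := by
    refine (forall_eval_sum (P := fun A => (0 : Multiset (ZMod n)) ∈ Lang.residual _ A)
      (fun A B => by rw [Lang.residual_add]; exact Iff.rfl) σ _ _).2 ?_
    simp only [List.forall_mem_map]
    intro i _
    refine Lang.forall_mem_mul.2 fun x hx y hy => ?_
    obtain ⟨x, rfl, z, rfl, rfl⟩ := hx
    obtain rfl := hy
    exact ⟨i, by simp⟩
  rw [h] at h0
  have := card_of_mem_cycleTriples (h0 {0} (Or.inr rfl))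
  simp at this

theorem S4123.nonfinitelyBased : NonfinitelyBased S4123 := by
  rintro ⟨E, hE, hK⟩
  have hS : (⟨S4123⟩ : BAlg) ∈ models E := hK ▸ fun K _ hA => hA
  obtain ⟨N, hN⟩ := (hE.image fun e => e.1.leaves.length + e.2.leaves.length).bddAbove
  have hN (e) (he : e ∈ E) : e.1.leaves.length + e.2.leaves.length ≤ N := hN ⟨e, he, rfl⟩
  -- This n is not divisible by 3, is at least 7 and exceeds 5(N + 1).
  obtain ⟨n, hn⟩ : ∃ n, n = 3 * (2 * N + 3) + 1 := ⟨_, rfl⟩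
  have : NeZero n := ⟨by omega⟩
  have hB : (⟨Lang.Syntactic (cycleTriples n)⟩ : BAlg) ∈ models E := fun e he =>
    syntactic_satisfies (hS e he) (by omega) (by have := hN e he; omega)
      (by have := hN e he; omega)
  rw [← hK] at hB
  exact syntactic_not_satisfies
    (hB _ (isVariety_satisfies _ _) (satisfies_cycleTerm (n := n) (by omega)))

end FiniteBasis

theorem mainTheorem11 :
    FiniteBasis.IsAISemiring FiniteBasis.S4123 ∧
    (∀ (V : Type) [Fintype V] (H : FiniteBasis.Hypergraph3 V) (hE : H.edges.Nonempty),
      H.NoIsolatedVertices → ¬ H.TwoColourable →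
        ∀ v : V, FiniteBasis.Satisfies FiniteBasis.S4123
          (H.term hE) (.add (H.term hE) (.var v))) ∧
    FiniteBasis.NonfinitelyBased FiniteBasis.S4123 :=
  ⟨FiniteBasis.S4123.isAISemiring,
    fun _ _ H hE hV hc v => H.satisfies_of_not_twoColourable hE hV hc v,
    FiniteBasis.S4123.nonfinitelyBased⟩
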